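/- An algebraic formula over a field $\mathbb F$ in the variables $x_1,\dots,x_n$ is a rooted binary tree whose leaves are labelled by variables or by constants from $\mathbb F$ and whose inner vertices are sum or product gates; it computes a polynomial in $\mathbb F[x_1,\dots,x_n]$ in the natural way. Its size is the number of its leaves that are labelled by variables (so the size is at most the number of all leaves and at most the number of all vertices). For $d\in\mathbb N$ let $$\mathrm{esym}(n,d)=\sum_{S\subseteq[n],\ |S|=d}\ \prod_{j\in S}x_j .$$ There are absolute constants $c,C>0$ and $N\in\mathbb N$ such that the following holds for every $n\ge N$, every field $\mathbb F$, and $d=0.1n$, where, if $10\nmid n$, the number $0.1n$ may be rounded either down or up. (1) If the characteristic of $\mathbb F$ is $0$ or greater than $0.1n$, then every algebraic formula over $\mathbb F$ that computes $\mathrm{esym}(n,d)$ has size at least $c\,n^2$. (2) (Ben-Or's matching upper bound.) If $\mathbb F$ has more than $n$ elements, then $\mathrm{esym}(n,d)$ is computed by an algebraic formula over $\mathbb F$ with at most $C\,n^2$ vertices, and hence of size at most $C\,n^2$. -/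

import Mathlib

/-- Algebraic formulas over `F` in variables indexed by `σ`: rooted trees whose leaves are labelled by
variables or field constants and whose inner vertices are binary sum and product gates. -/
inductive AlgFormula (F : Type*) (σ : Type*) where
  | var (i : σ) : AlgFormula F σ
  | const (a : F) : AlgFormula F σ
  | add (Φ Ψ : AlgFormula F σ) : AlgFormula F σ
  | mul (Φ Ψ : AlgFormula F σ) : AlgFormula F σ

namespace AlgFormula

/-- The (formal) polynomial computed by a formula. -/
noncomputable def toPoly {F σ : Type*} [CommSemiring F] : AlgFormula F σ → MvPolynomial σ F
  | var i => MvPolynomial.X i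
  | const a => MvPolynomial.C a
  | add Φ Ψ => Φ.toPoly + Ψ.toPoly
  | mul Φ Ψ => Φ.toPoly * Ψ.toPoly

/-- The size of a formula: the number of leaves labelled by variables (leaves labelled by
constants are free). It is at most the number of all leaves, and the number of all vertices. -/
def size {F σ : Type*} : AlgFormula F σ → ℕ
  | var _ => 1
  | const _ => 0
  | add Φ Ψ => Φ.size + Ψ.size
  | mul Φ Ψ => Φ.size + Ψ.size

/-- The number of all vertices (leaves of both kinds, and gates) of a formula. -/
def numVertices {F σ : Type*} : AlgFormula F σ → ℕ
  | var _ => 1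
  | const _ => 1
  | add Φ Ψ => Φ.numVertices + Ψ.numVertices + 1
  | mul Φ Ψ => Φ.numVertices + Ψ.numVertices + 1

end AlgFormula

/-!
Repeatedly splitting off a subformula of degree about `d / 2` writes `esym(n, d)`, up to terms of
degree less than `d`, as an element of `I ^ 2`, where `I` is generated by `O(size / d)` polynomials
vanishing at the origin. Hence `∂ⱼ esym(n, d) ∈ I` up to terms of degree less than `d - 1`, while
`∂ⱼ eₖ₊₁ = eₖ - xⱼ ∂ⱼ eₖ` gives `∂ⱼ esym(n, d) ≡ (-xⱼ) ^ (d - 1)` modulo `e₁, …, e_{d-1}`. So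
`I + (e₁, …, e_{d-1})` has a finite-dimensional quotient, and Krull's height theorem at the origin
shows that it needs at least `n` generators, that is, `size ≳ d (n - d)`.

For the upper bound, `esym(n, d)` is a coefficient of `∏ᵢ (T + xᵢ)`, hence a linear combination of
the values of this product at `n + 1` points `T = a`.
-/

open MvPolynomial

section Derivatives

theorem derivation_apply_mem_of_mem_sq {R A : Type*} [CommSemiring R] [CommRing A] [Algebra R A]
    (δ : Derivation R A A) {I : Ideal A} {a : A} (ha : a ∈ I ^ 2) : δ a ∈ I := by
  rw [pow_two] at ha
  refine Submodule.mul_induction_on ha (fun x hx y hy => ?_) (fun x y hx hy => ?_)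
  · rw [δ.leibniz, smul_eq_mul, smul_eq_mul]
    exact I.add_mem (I.mul_mem_right _ hx) (I.mul_mem_right _ hy)
  · rw [map_add]
    exact I.add_mem hx hy

theorem totalDegree_pderiv_le {σ R : Type*} [CommSemiring R] (j : σ) (f : MvPolynomial σ R) :
    (pderiv j f).totalDegree ≤ f.totalDegree - 1 := by
  refine Finset.sup_le fun m hm => ?_
  rw [mem_support_iff, coeff_pderiv] at hm
  have hle := le_totalDegree (mem_support_iff.2 (left_ne_zero_of_mul hm))
  rw [Finsupp.sum_add_index' (by simp) (by simp), Finsupp.sum_single_index rfl] at hle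
  omega

end Derivatives

section ElementarySymmetric

theorem constantCoeff_esymm_succ {σ R : Type*} [Fintype σ] [CommSemiring R] (k : ℕ) :
    constantCoeff (esymm σ R (k + 1)) = 0 := by
  rw [esymm, map_sum]
  refine Finset.sum_eq_zero fun s hs => ?_
  simp [Finset.mem_powersetCard_univ.1 hs]

variable (σ R : Type*) [Fintype σ] [DecidableEq σ] [CommSemiring R]

/-- The `k`-th elementary symmetric polynomial in the variables other than `X j`. -/
noncomputable def esymmErase (j : σ) (k : ℕ) : MvPolynomial σ R :=
  ∑ t ∈ (Finset.univ.erase j).powersetCard k, ∏ i ∈ t, X i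

variable {σ R}

theorem esymmErase_zero (j : σ) : esymmErase σ R j 0 = 1 := by
  simp [esymmErase]

theorem esymm_succ_eq_esymmErase (j : σ) (k : ℕ) :
    esymm σ R (k + 1) = esymmErase σ R j (k + 1) + X j * esymmErase σ R j k := by
  have hj : j ∉ Finset.univ.erase j := Finset.notMem_erase j _
  have hnot {m : ℕ} {t : Finset σ} (ht : t ∈ (Finset.univ.erase j).powersetCard m) : j ∉ t :=
    fun h => hj ((Finset.mem_powersetCard.1 ht).1 h)
  rw [esymm, ← Finset.insert_erase (Finset.mem_univ j), Finset.powersetCard_succ_insert hj,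
    Finset.sum_union, Finset.sum_image, esymmErase, esymmErase, Finset.mul_sum]
  · exact congrArg _ (Finset.sum_congr rfl fun t ht => Finset.prod_insert (hnot ht))
  · exact fun t ht u hu h => by
      rw [← Finset.erase_insert (hnot ht), h, Finset.erase_insert (hnot hu)]
  · rw [Finset.disjoint_left]
    intro t ht ht'
    obtain ⟨u, -, rfl⟩ := Finset.mem_image.1 ht'
    exact hnot ht (Finset.mem_insert_self j u)

theorem pderiv_esymmErase (j : σ) (k : ℕ) : pderiv j (esymmErase σ R j k) = 0 := by
  rw [esymmErase, map_sum]
  refine Finset.sum_eq_zero fun t ht => ?_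
  refine Finset.prod_induction _ (fun p => pderiv j p = 0) (fun p q hp hq => ?_) pderiv_one
    fun i hi => pderiv_X_of_ne ?_
  · rw [pderiv_mul, hp, hq, zero_mul, mul_zero, add_zero]
  · exact Finset.ne_of_mem_erase ((Finset.mem_powersetCard.1 ht).1 hi)

theorem pderiv_esymm_succ (j : σ) (k : ℕ) :
    pderiv j (esymm σ R (k + 1)) = esymmErase σ R j k := by
  rw [esymm_succ_eq_esymmErase j, map_add, pderiv_mul, pderiv_esymmErase, pderiv_esymmErase,
    pderiv_X_self, zero_add, one_mul, mul_zero, add_zero]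

theorem esymmErase_sub_neg_X_pow_mem {σ R : Type*} [Fintype σ] [DecidableEq σ] [CommRing R]
    {I : Ideal (MvPolynomial σ R)} (j : σ) {m : ℕ}
    (hI : ∀ k < m, esymm σ R (k + 1) ∈ I) : esymmErase σ R j m - (-X j) ^ m ∈ I := by
  induction m with
  | zero => simp [esymmErase_zero]
  | succ m ih =>
    have hrec : esymmErase σ R j (m + 1) - (-X j) ^ (m + 1) =
        esymm σ R (m + 1) - X j * (esymmErase σ R j m - (-X j) ^ m) := by
      rw [esymm_succ_eq_esymmErase j]
      ring
    rw [hrec]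
    exact I.sub_mem (hI m m.lt_succ_self)
      (I.mul_mem_left _ (ih fun k hk => hI k (hk.trans m.lt_succ_self)))

end ElementarySymmetric

section FiniteQuotient

theorem mem_of_forall_monomial_mem {σ R : Type*} [CommSemiring R]
    {W : Submodule R (MvPolynomial σ R)}
    {p : MvPolynomial σ R} (h : ∀ s ∈ p.support, monomial s 1 ∈ W) : p ∈ W := by
  rw [← support_sum_monomial_coeff p]
  refine W.sum_mem fun s hs => ?_
  rw [← mul_one (coeff s p), ← smul_eq_mul, ← smul_monomial]
  exact W.smul_mem _ (h s hs)

variable {σ R : Type*} [CommRing R]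

theorem exists_totalDegree_lt_monomial_sub_mem {I : Ideal (MvPolynomial σ R)} {e : ℕ} {j : σ}
    {r : MvPolynomial σ R} (hr : r.totalDegree < e) (hI : X j ^ e - r ∈ I) {s : σ →₀ ℕ}
    (hs : e ≤ s j) :
    ∃ q : MvPolynomial σ R, q.totalDegree < s.degree ∧ monomial s 1 - q ∈ I := by
  obtain ⟨u, rfl⟩ := exists_add_of_le (Finsupp.single_le_iff.2 hs)
  refine ⟨monomial u 1 * r, ?_, ?_⟩
  · have hu : (monomial u (1 : R)).totalDegree ≤ u.degree := totalDegree_monomial_le u 1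
    rw [map_add, Finsupp.degree_single]
    exact (totalDegree_mul _ _).trans_lt (by omega)
  · have hsplit : monomial (Finsupp.single j e + u) (1 : R) - monomial u 1 * r =
        monomial u 1 * (X j ^ e - r) := by
      rw [X_pow_eq_monomial, mul_sub, monomial_mul, one_mul, add_comm u]
    rw [hsplit]
    exact I.mul_mem_left _ hI

theorem restrictTotalDegree_sup_eq_top [Fintype σ] {I : Ideal (MvPolynomial σ R)} {e : ℕ}
    (h : ∀ j, ∃ r : MvPolynomial σ R, r.totalDegree < e ∧ X j ^ e - r ∈ I) :
    restrictTotalDegree σ R (Fintype.card σ * e) ⊔ I.restrictScalars R = ⊤ := by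
  set W := restrictTotalDegree σ R (Fintype.card σ * e) ⊔ I.restrictScalars R
  suffices hW : ∀ N, ∀ p : MvPolynomial σ R, p.totalDegree < N → p ∈ W from
    eq_top_iff.2 fun p _ => hW _ p p.totalDegree.lt_succ_self
  intro N
  induction N with
  | zero => exact fun p hp => absurd hp (Nat.not_lt_zero _)
  | succ N ih =>
    refine fun p hp => mem_of_forall_monomial_mem fun s hs => ?_
    have hsN : s.degree ≤ N := (le_totalDegree hs).trans (Nat.lt_succ_iff.1 hp)
    by_cases hsmall : s.degree ≤ Fintype.card σ * e
    · exact Submodule.mem_sup_left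
        ((mem_restrictTotalDegree _ _ _).2 ((totalDegree_monomial_le s 1).trans hsmall))
    obtain ⟨j, hj⟩ : ∃ j, e ≤ s j := by
      by_contra! hlt
      refine hsmall ?_
      rw [Finsupp.degree_eq_sum]
      exact Finset.sum_le_card_nsmul _ _ _ fun j _ => (hlt j).le
    obtain ⟨r, hr, hrI⟩ := h j
    obtain ⟨q, hq, hqI⟩ := exists_totalDegree_lt_monomial_sub_mem hr hrI hj
    rw [← sub_add_cancel (monomial s 1) q]
    exact W.add_mem (Submodule.mem_sup_right hqI) (ih q (hq.trans_le hsN))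

theorem finite_quotient_of_X_pow_sub_mem [Finite σ] {I : Ideal (MvPolynomial σ R)} {e : ℕ}
    (h : ∀ j, ∃ r : MvPolynomial σ R, r.totalDegree < e ∧ X j ^ e - r ∈ I) :
    Module.Finite R (MvPolynomial σ R ⧸ I) := by
  have := Fintype.ofFinite σ
  let π := (Ideal.Quotient.mkₐ R I).toLinearMap
  refine Module.Finite.of_surjective
    (π.comp (restrictTotalDegree σ R (Fintype.card σ * e)).subtype) fun x => ?_
  obtain ⟨p, rfl⟩ := Ideal.Quotient.mk_surjective x
  obtain ⟨q, hq, z, hz, rfl⟩ := Submodule.mem_sup.1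
    (restrictTotalDegree_sup_eq_top h ▸ Submodule.mem_top (x := p))
  exact ⟨⟨q, hq⟩, Ideal.Quotient.eq.2 (by simpa using I.neg_mem hz)⟩

end FiniteQuotient

section Height

variable {σ : Type*}

/-- The evaluation `X i ↦ 0` for `i ∈ s`; its kernel is the prime ideal of the coordinate subspace
cut out by the variables in `s`. -/
noncomputable def killVars (R : Type*) [CommSemiring R] [DecidableEq σ] (s : Finset σ) :
    MvPolynomial σ R →ₐ[R] MvPolynomial σ R :=
  aeval fun i => if i ∈ s then 0 else X i

theorem ker_killVars_lt_ker_killVars_insert {R : Type*} [CommSemiring R] [Nontrivial R]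
    [DecidableEq σ] {s : Finset σ} {a : σ} (ha : a ∉ s) :
    RingHom.ker (killVars R s) < RingHom.ker (killVars R (insert a s)) := by
  have hcomp : (killVars R (insert a s)).comp (killVars R s) = killVars R (insert a s) := by
    refine algHom_ext fun i => ?_
    by_cases hi : i ∈ s <;> simp [killVars, hi]
  refine SetLike.lt_iff_le_and_exists.2 ⟨fun p hp => ?_, X a, ?_, ?_⟩
  · rw [RingHom.mem_ker] at hp ⊢
    rw [← hcomp, AlgHom.comp_apply, hp, map_zero]
  · simp [RingHom.mem_ker, killVars]
  · simp [RingHom.mem_ker, killVars, ha]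

theorem card_le_height_ker_killVars {R : Type*} [CommRing R] [IsDomain R] [DecidableEq σ]
    (s : Finset σ) : (s.card : ℕ∞) ≤ (RingHom.ker (killVars R s)).height := by
  induction s using Finset.induction_on with
  | empty => simp
  | insert a s ha ih =>
    have := RingHom.ker_isPrime (killVars R s)
    have := RingHom.ker_isPrime (killVars R (insert a s))
    rw [Finset.card_insert_of_notMem ha, Nat.cast_add_one]
    exact (add_le_add_left ih 1).trans
      (Ideal.height_add_one_le_of_lt_of_isPrime (ker_killVars_lt_ker_killVars_insert ha))

theorem card_le_height_ker_constantCoeff (R : Type*) [CommRing R] [IsDomain R] [Fintype σ] :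
    (Fintype.card σ : ℕ∞) ≤ (RingHom.ker (constantCoeff : MvPolynomial σ R →+* R)).height := by
  classical
  have hcomp : constantCoeff.comp (killVars R (Finset.univ : Finset σ)).toRingHom =
      constantCoeff := by
    refine ringHom_ext (fun r => ?_) fun i => ?_ <;> simp [killVars]
  refine (card_le_height_ker_killVars (R := R) Finset.univ).trans (Ideal.height_mono fun p hp => ?_)
  rw [RingHom.mem_ker] at hp ⊢
  rw [← hcomp]
  exact (congrArg constantCoeff hp).trans (map_zero _)

/-- Krull's height theorem at the origin, which is an isolated zero of `T` because the quotient by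
`T` is Artinian. -/
theorem card_le_card_of_finite_quotient_span {F : Type*} [Field F] [Fintype σ]
    (T : Finset (MvPolynomial σ F)) (hT : ∀ p ∈ T, constantCoeff p = 0)
    [Module.Finite F (MvPolynomial σ F ⧸ Ideal.span (T : Set (MvPolynomial σ F)))] :
    Fintype.card σ ≤ T.card := by
  have hmin : RingHom.ker (constantCoeff : MvPolynomial σ F →+* F) ∈
      (Ideal.span (T : Set (MvPolynomial σ F))).minimalPrimes := by
    refine ⟨⟨RingHom.ker_isPrime _, Ideal.span_le.2 hT⟩, ?_⟩
    rintro p ⟨hp, hTp⟩ hle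
    have : Module.Finite F (MvPolynomial σ F ⧸ p) :=
      Module.Finite.of_surjective (Ideal.Quotient.factorₐ F hTp).toLinearMap
        (Ideal.Quotient.factor_surjective hTp)
    have hmax : p.IsMaximal := Ideal.Quotient.maximal_of_isField _
      (isField_of_isIntegral_of_isField' (R := F) (Field.toIsField F))
    exact (hmax.eq_of_le (RingHom.ker_ne_top _) hle).ge
  exact_mod_cast (card_le_height_ker_constantCoeff F).trans
    (Ideal.height_le_card_of_mem_minimalPrimes_span_finset hmin)

end Height

section EsymmRank

variable {σ : Type*} [Fintype σ]

theorem X_pow_sub_smul_pderiv_mem {R : Type*} [CommRing R] {I : Ideal (MvPolynomial σ R)} {e : ℕ}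
    (hI : ∀ k < e, esymm σ R (k + 1) ∈ I) {r : MvPolynomial σ R}
    (hr : esymm σ R (e + 1) - r ∈ I ^ 2) (j : σ) :
    X j ^ e - (-1 : R) ^ e • pderiv j r ∈ I := by
  classical
  have hderiv := derivation_apply_mem_of_mem_sq (pderiv j) hr
  rw [map_sub, pderiv_esymm_succ] at hderiv
  have hneg : (-X j) ^ e - pderiv j r ∈ I := by
    simpa using I.sub_mem hderiv (esymmErase_sub_neg_X_pow_mem j hI)
  have hsign : X j ^ e - (-1 : R) ^ e • pderiv j r =
      (-1 : R) ^ e • ((-X j) ^ e - pderiv j r) := by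
    rw [smul_sub, ← smul_pow, neg_smul, one_smul, neg_neg]
  rw [hsign]
  exact (I.restrictScalars R).smul_mem _ hneg

theorem card_le_card_add_of_esymm_sub_mem_sq {F : Type*} [Field F] {e : ℕ} (he : 0 < e)
    {S : Finset (MvPolynomial σ F)} (hS : ∀ p ∈ S, constantCoeff p = 0)
    {r : MvPolynomial σ F} (hr : r.totalDegree ≤ e)
    (h : esymm σ F (e + 1) - r ∈ Ideal.span (S : Set (MvPolynomial σ F)) ^ 2) :
    Fintype.card σ ≤ S.card + e := by
  classical
  let E : Finset (MvPolynomial σ F) := (Finset.range e).image fun k => esymm σ F (k + 1)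
  have hE : E.card ≤ e := Finset.card_image_le.trans (Finset.card_range e).le
  have hzero : ∀ p ∈ S ∪ E, constantCoeff p = 0 := by
    simp only [E, Finset.mem_union, Finset.mem_image]
    rintro p (hp | ⟨k, -, rfl⟩)
    · exact hS p hp
    · exact constantCoeff_esymm_succ k
  have hEI : ∀ k < e, esymm σ F (k + 1) ∈ Ideal.span ((S ∪ E : Finset _) : Set _) := fun k hk =>
    Ideal.subset_span (Finset.mem_union_right _ (Finset.mem_image_of_mem _ (Finset.mem_range.2 hk)))
  have hSI := Ideal.pow_right_mono
    (Ideal.span_mono (Finset.coe_subset.2 (Finset.subset_union_left (s₁ := S) (s₂ := E)))) 2 h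
  have hdeg (j : σ) : ((-1 : F) ^ e • pderiv j r).totalDegree < e := by
    have := (totalDegree_smul_le ((-1 : F) ^ e) (pderiv j r)).trans (totalDegree_pderiv_le j r)
    omega
  have := finite_quotient_of_X_pow_sub_mem fun j =>
    ⟨_, hdeg j, X_pow_sub_smul_pderiv_mem hEI hSI j⟩
  calc Fintype.card σ ≤ (S ∪ E).card := card_le_card_of_finite_quotient_span _ hzero
    _ ≤ S.card + E.card := Finset.card_union_le S E
    _ ≤ S.card + e := by omega

end EsymmRank

namespace AlgFormula

section LowerBound

variable {F σ : Type*}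

theorem totalDegree_toPoly_le_size [CommSemiring F] (Φ : AlgFormula F σ) :
    Φ.toPoly.totalDegree ≤ Φ.size := by
  induction Φ with
  | var i => exact (totalDegree_monomial_le _ _).trans (Finsupp.sum_single_index rfl).le
  | const a => exact (totalDegree_C a).le
  | add Φ Ψ hΦ hΨ =>
    exact (totalDegree_add _ _).trans (max_le (hΦ.trans le_self_add) (hΨ.trans le_add_self))
  | mul Φ Ψ hΦ hΨ => exact (totalDegree_mul _ _).trans (add_le_add hΦ hΨ)

/-- Replacing a subformula of `Φ` by a constant saves at least `D` variable leaves and changes the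
computed polynomial by a multiple of a polynomial `V` without constant term, of degree less than
`2 * D`. -/
def SplitsOff [CommSemiring F] (D : ℕ) (Φ : AlgFormula F σ) : Prop :=
  ∃ (A V : MvPolynomial σ F) (Ψ : AlgFormula F σ), Φ.toPoly = A * V + Ψ.toPoly ∧
    constantCoeff V = 0 ∧ V.totalDegree < 2 * D ∧ Ψ.size + D ≤ Φ.size

theorem splitsOff_of_totalDegree_lt [CommRing F] {D : ℕ} {Φ : AlgFormula F σ}
    (hdeg : Φ.toPoly.totalDegree < 2 * D) (hsize : D ≤ Φ.size) : Φ.SplitsOff D := by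
  refine ⟨1, Φ.toPoly - C (constantCoeff Φ.toPoly), const (constantCoeff Φ.toPoly), ?_, ?_, ?_, ?_⟩
  · simp [toPoly]
  · simp
  · exact (totalDegree_sub_C_le _ _).trans_lt hdeg
  · simpa [size] using hsize

section Gates

variable [CommSemiring F] {D : ℕ} {Φ Ψ : AlgFormula F σ}

theorem SplitsOff.add_left (h : Φ.SplitsOff D) : (add Φ Ψ).SplitsOff D := by
  obtain ⟨A, V, Φ', hΦ, hV, hdeg, hsize⟩ := h
  refine ⟨A, V, add Φ' Ψ, ?_, hV, hdeg, ?_⟩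
  · simp only [toPoly, hΦ, add_assoc]
  · simp only [size]; omega

theorem SplitsOff.add_right (h : Ψ.SplitsOff D) : (add Φ Ψ).SplitsOff D := by
  obtain ⟨A, V, Ψ', hΨ, hV, hdeg, hsize⟩ := h
  refine ⟨A, V, add Φ Ψ', ?_, hV, hdeg, ?_⟩
  · simp only [toPoly, hΨ]; ring
  · simp only [size]; omega

theorem SplitsOff.mul_left (h : Φ.SplitsOff D) : (mul Φ Ψ).SplitsOff D := by
  obtain ⟨A, V, Φ', hΦ, hV, hdeg, hsize⟩ := h
  refine ⟨A * Ψ.toPoly, V, mul Φ' Ψ, ?_, hV, hdeg, ?_⟩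
  · simp only [toPoly, hΦ]; ring
  · simp only [size]; omega

theorem SplitsOff.mul_right (h : Ψ.SplitsOff D) : (mul Φ Ψ).SplitsOff D := by
  obtain ⟨A, V, Ψ', hΨ, hV, hdeg, hsize⟩ := h
  refine ⟨Φ.toPoly * A, V, mul Φ Ψ', ?_, hV, hdeg, ?_⟩
  · simp only [toPoly, hΨ]; ring
  · simp only [size]; omega

end Gates

variable [CommRing F] {D : ℕ}

theorem splitsOff_of_le_totalDegree (hD : 0 < D) (Φ : AlgFormula F σ)
    (h : D ≤ Φ.toPoly.totalDegree) : Φ.SplitsOff D := by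
  induction Φ with
  | var i =>
    have hle := totalDegree_toPoly_le_size (var i : AlgFormula F σ)
    exact splitsOff_of_totalDegree_lt (by simp only [size] at hle; omega) (h.trans hle)
  | const a =>
    rw [toPoly, totalDegree_C] at h
    omega
  | add Φ Ψ hΦ hΨ =>
    rcases le_max_iff.1 (h.trans (totalDegree_add _ _)) with h | h
    · exact (hΦ h).add_left
    · exact (hΨ h).add_right
  | mul Φ Ψ hΦ hΨ =>
    by_cases hDΦ : D ≤ Φ.toPoly.totalDegree
    · exact (hΦ hDΦ).mul_left
    by_cases hDΨ : D ≤ Ψ.toPoly.totalDegree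
    · exact (hΨ hDΨ).mul_right
    refine splitsOff_of_totalDegree_lt ?_ (h.trans (totalDegree_toPoly_le_size _))
    exact (totalDegree_mul _ _).trans_lt (by omega)

/-- Each split-off product `A * V` contributes the generators `V` and `A - A(0)`, and leaves
`A(0) * V` in the low-degree remainder. -/
theorem exists_sub_mem_span_sq (hD : 0 < D) (Φ : AlgFormula F σ) :
    ∃ (t : ℕ) (S : Finset (MvPolynomial σ F)) (r : MvPolynomial σ F),
      t * D ≤ Φ.size ∧ S.card ≤ 2 * t ∧ (∀ p ∈ S, constantCoeff p = 0) ∧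
      r.totalDegree < 2 * D ∧ Φ.toPoly - r ∈ Ideal.span (S : Set (MvPolynomial σ F)) ^ 2 := by
  classical
  induction hs : Φ.size using Nat.strong_induction_on generalizing Φ with
  | _ s ih =>
    subst hs
    rcases lt_or_ge Φ.toPoly.totalDegree D with hlow | hhigh
    · exact ⟨0, ∅, Φ.toPoly, by simp, by simp, by simp, by omega, by simp⟩
    obtain ⟨A, V, Ψ, hΦ, hV, hVdeg, hsize⟩ := splitsOff_of_le_totalDegree hD Φ hhigh
    obtain ⟨t, S, r, ht, hcard, hS, hrdeg, hmem⟩ := ih Ψ.size (by omega) Ψ rfl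
    let A₀ := A - C (constantCoeff A)
    have hspan : Ideal.span (S : Set (MvPolynomial σ F)) ≤
        Ideal.span ((insert A₀ (insert V S) : Finset _) : Set (MvPolynomial σ F)) :=
      Ideal.span_mono (Finset.coe_subset.2
        ((Finset.subset_insert V S).trans (Finset.subset_insert A₀ _)))
    have hsplit : Φ.toPoly - (constantCoeff A • V + r) = A₀ * V + (Ψ.toPoly - r) := by
      rw [hΦ, smul_eq_C_mul]
      ring
    refine ⟨t + 1, insert A₀ (insert V S), constantCoeff A • V + r, ?_, ?_, ?_, ?_, ?_⟩
    · rw [add_one_mul]; omega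
    · have := Finset.card_insert_le A₀ (insert V S)
      have := Finset.card_insert_le V S
      omega
    · simp only [Finset.forall_mem_insert]
      exact ⟨by simp [A₀], hV, hS⟩
    · exact (totalDegree_add _ _).trans_lt
        (max_lt ((totalDegree_smul_le _ _).trans_lt hVdeg) hrdeg)
    · rw [hsplit]
      refine Ideal.add_mem _ ?_ (Ideal.pow_right_mono hspan 2 hmem)
      rw [pow_two]
      exact Ideal.mul_mem_mul (Ideal.subset_span (by simp)) (Ideal.subset_span (by simp))

end LowerBound

theorem mul_le_size_of_toPoly_eq_esymm {F σ : Type*} [Field F] [Fintype σ] {d : ℕ}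
    {Φ : AlgFormula F σ} (hΦ : Φ.toPoly = esymm σ F d) :
    (d - 1) * (Fintype.card σ - d) ≤ 4 * Φ.size := by
  obtain hd | hd := Nat.lt_or_ge d 2
  · simp [Nat.sub_eq_zero_of_le (Nat.lt_succ_iff.1 hd)]
  obtain ⟨e, rfl⟩ : ∃ e, d = e + 1 := ⟨d - 1, by omega⟩
  obtain ⟨t, S, r, ht, hcard, hS, hr, hmem⟩ :=
    exists_sub_mem_span_sq (D := (e + 1) / 2) (by omega) Φ
  rw [hΦ] at hmem
  have hrank := card_le_card_add_of_esymm_sub_mem_sq (by omega) hS (by omega) hmem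
  calc (e + 1 - 1) * (Fintype.card σ - (e + 1))
      ≤ (2 * ((e + 1) / 2)) * (2 * t) := Nat.mul_le_mul (by omega) (by omega)
    _ = 4 * (t * ((e + 1) / 2)) := by ring
    _ ≤ 4 * Φ.size := Nat.mul_le_mul_left 4 ht

section UpperBound

variable {F σ ι : Type*}

theorem numVertices_foldr {op : AlgFormula F σ → AlgFormula F σ → AlgFormula F σ}
    (hop : ∀ Φ Ψ, (op Φ Ψ).numVertices = Φ.numVertices + Ψ.numVertices + 1) (Φ₀ : AlgFormula F σ)
    (l : List (AlgFormula F σ)) :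
    (l.foldr op Φ₀).numVertices = (l.map fun Φ => Φ.numVertices + 1).sum + Φ₀.numVertices := by
  induction l with
  | nil => simp
  | cons Φ l ih =>
    rw [List.foldr_cons, hop, ih, List.map_cons, List.sum_cons]
    omega

variable [CommSemiring F]

/-- A formula for the sum of a finite family of formulas. -/
noncomputable def finsetSum (s : Finset ι) (f : ι → AlgFormula F σ) : AlgFormula F σ :=
  (s.toList.map f).foldr add (const 0)

/-- A formula for the product of a finite family of formulas. -/
noncomputable def finsetProd (s : Finset ι) (f : ι → AlgFormula F σ) : AlgFormula F σ :=
  (s.toList.map f).foldr mul (const 1)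

theorem toPoly_finsetSum (s : Finset ι) (f : ι → AlgFormula F σ) :
    (finsetSum s f).toPoly = ∑ i ∈ s, (f i).toPoly := by
  rw [finsetSum, ← Finset.sum_map_toList]
  induction s.toList with
  | nil => simp [toPoly]
  | cons i l ih => simp [toPoly, ih]

theorem toPoly_finsetProd (s : Finset ι) (f : ι → AlgFormula F σ) :
    (finsetProd s f).toPoly = ∏ i ∈ s, (f i).toPoly := by
  rw [finsetProd, ← Finset.prod_map_toList]
  induction s.toList with
  | nil => simp [toPoly]
  | cons i l ih => simp [toPoly, ih]

theorem numVertices_finsetSum (s : Finset ι) (f : ι → AlgFormula F σ) :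
    (finsetSum s f).numVertices = ∑ i ∈ s, ((f i).numVertices + 1) + 1 := by
  rw [finsetSum, numVertices_foldr fun _ _ => rfl, List.map_map, ← Finset.sum_map_toList]
  rfl

theorem numVertices_finsetProd (s : Finset ι) (f : ι → AlgFormula F σ) :
    (finsetProd s f).numVertices = ∑ i ∈ s, ((f i).numVertices + 1) + 1 := by
  rw [finsetProd, numVertices_foldr fun _ _ => rfl, List.map_map, ← Finset.sum_map_toList]
  rfl

end UpperBound

end AlgFormula

section Interpolation

variable {F : Type*} [Field F] [DecidableEq F]

theorem sum_coeff_lagrangeBasis_mul_pow (s : Finset F) {m : ℕ} (hm : m < s.card) (k : ℕ) :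
    ∑ a ∈ s, (Lagrange.basis s id a).coeff k * a ^ m = if k = m then 1 else 0 := by
  have hinterp := Lagrange.eq_interpolate (f := (Polynomial.X ^ m : Polynomial F)) (s := s)
    (v := id) Function.injective_id.injOn (by simpa using hm)
  rw [← Polynomial.coeff_X_pow, hinterp, Lagrange.interpolate_apply, Polynomial.finsetSum_coeff]
  refine Finset.sum_congr rfl fun a _ => ?_
  rw [Polynomial.coeff_C_mul, Polynomial.eval_pow, Polynomial.eval_X, id, mul_comm]

theorem coeff_eq_sum_lagrangeBasis_mul_eval {A : Type*} [CommRing A] [Algebra F A] {s : Finset F}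
    {p : Polynomial A} (hp : p.natDegree < s.card) (k : ℕ) :
    p.coeff k = ∑ a ∈ s,
      algebraMap F A ((Lagrange.basis s id a).coeff k) * p.eval (algebraMap F A a) := by
  have hsum : ∀ m ∈ Finset.range s.card,
      ∑ a ∈ s, algebraMap F A ((Lagrange.basis s id a).coeff k) * algebraMap F A a ^ m =
        if k = m then 1 else 0 := fun m hm => by
    simp only [← map_pow, ← map_mul, ← map_sum]
    rw [sum_coeff_lagrangeBasis_mul_pow s (Finset.mem_range.1 hm)]
    split_ifs <;> simp
  symm
  calc ∑ a ∈ s, algebraMap F A ((Lagrange.basis s id a).coeff k) * p.eval (algebraMap F A a)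
      = ∑ m ∈ Finset.range s.card, p.coeff m * ∑ a ∈ s,
          algebraMap F A ((Lagrange.basis s id a).coeff k) * algebraMap F A a ^ m := by
        simp only [Polynomial.eval_eq_sum_range' hp, Finset.mul_sum]
        rw [Finset.sum_comm]
        exact Finset.sum_congr rfl fun m _ => Finset.sum_congr rfl fun a _ => by ring
    _ = ∑ m ∈ Finset.range s.card, if k = m then p.coeff m else 0 :=
        Finset.sum_congr rfl fun m hm => by rw [hsum m hm, mul_ite, mul_one, mul_zero]
    _ = p.coeff k := by
        rw [Finset.sum_ite_eq, ite_eq_left_iff, Finset.mem_range, not_lt]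
        exact fun hk => (Polynomial.coeff_eq_zero_of_natDegree_lt (hp.trans_le hk)).symm

end Interpolation

namespace AlgFormula

section BenOr

variable {F σ : Type*} [Field F] [DecidableEq F] [Fintype σ]

/-- Ben-Or's formula: the coefficient of `T ^ (card σ - d)` in `∏ i, (T + X i)`, recovered by
Lagrange interpolation from the values at `T = a`, `a ∈ s`. -/
noncomputable def benOr (s : Finset F) (d : ℕ) : AlgFormula F σ :=
  finsetSum s fun a => mul (const ((Lagrange.basis s id a).coeff (Fintype.card σ - d)))
    (finsetProd Finset.univ fun i => add (const a) (var i))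

theorem toPoly_benOr {s : Finset F} (hs : Fintype.card σ < s.card) {d : ℕ}
    (hd : d ≤ Fintype.card σ) : (benOr s d : AlgFormula F σ).toPoly = esymm σ F d := by
  let P : Polynomial (MvPolynomial σ F) := ∏ i : σ, (Polynomial.X + Polynomial.C (X i))
  have hP : P.natDegree < s.card := by
    refine lt_of_le_of_lt (Polynomial.natDegree_prod_le _ _) ?_
    simpa using hs
  have hcoeff : P.coeff (Fintype.card σ - d) = esymm σ F d := by
    rw [MvPolynomial.prod_X_add_C_coeff F σ _ (Nat.sub_le _ _), Nat.sub_sub_self hd]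
  rw [← hcoeff, coeff_eq_sum_lagrangeBasis_mul_eval hP, benOr, toPoly_finsetSum]
  refine Finset.sum_congr rfl fun a _ => ?_
  simp [P, toPoly, toPoly_finsetProd, Polynomial.eval_prod, algebraMap_eq]

theorem numVertices_benOr (s : Finset F) (d : ℕ) :
    (benOr s d : AlgFormula F σ).numVertices = 4 * s.card * (Fintype.card σ + 1) + 1 := by
  simp only [benOr, numVertices_finsetSum, numVertices, numVertices_finsetProd, Finset.sum_const,
    Finset.card_univ, smul_eq_mul]
  ring

end BenOr

theorem exists_toPoly_eq_esymm {F σ : Type*} [Field F] [Fintype σ]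
    (hF : (Fintype.card σ : ℕ∞) < ENat.card F) {d : ℕ} (hd : d ≤ Fintype.card σ) :
    ∃ Φ : AlgFormula F σ, Φ.toPoly = esymm σ F d ∧
      Φ.numVertices = 4 * (Fintype.card σ + 1) ^ 2 + 1 := by
  classical
  obtain ⟨t, -, ht⟩ := Set.exists_subset_encard_eq (s := (Set.univ : Set F))
    (k := (Fintype.card σ + 1 : ℕ)) (by
      rw [Set.encard_univ]
      exact_mod_cast Order.add_one_le_of_lt hF)
  obtain ⟨s, rfl⟩ := (Set.finite_of_encard_eq_coe ht).exists_finset_coe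
  have hs : s.card = Fintype.card σ + 1 := by
    rw [Set.encard_coe_eq_coe_finsetCard] at ht
    exact_mod_cast ht
  refine ⟨benOr s d, toPoly_benOr (by omega) hd, ?_⟩
  rw [numVertices_benOr, hs]
  ring

end AlgFormula

theorem near_tenth_of_eq_floor_or_eq_ceil {n d : ℕ}
    (hd : d = ⌊(n : ℝ) / 10⌋₊ ∨ d = ⌈(n : ℝ) / 10⌉₊) : n < 10 * d + 10 ∧ 10 * d < n + 10 := by
  have hn : (0 : ℝ) ≤ (n : ℝ) / 10 := by positivity
  have hlo : (n : ℝ) / 10 < d + 1 := by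
    rcases hd with rfl | rfl
    · exact Nat.lt_floor_add_one _
    · exact (Nat.le_ceil _).trans_lt (lt_add_one _)
  have hhi : (d : ℝ) < n / 10 + 1 := by
    rcases hd with rfl | rfl
    · exact (Nat.floor_le hn).trans_lt (lt_add_one _)
    · exact Nat.ceil_lt_add_one hn
  constructor
  · have : (n : ℝ) < 10 * d + 10 := by linarith
    exact_mod_cast this
  · have : 10 * (d : ℝ) < n + 10 := by linarith
    exact_mod_cast this

theorem theorem1p3_general :
    ∃ c C : ℝ, 0 < c ∧ 0 < C ∧ ∃ N : ℕ, ∀ n : ℕ, N ≤ n →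
      ∀ d : ℕ, (d = ⌊(n : ℝ) / 10⌋₊ ∨ d = ⌈(n : ℝ) / 10⌉₊) →
      ∀ (F : Type*) [Field F],
        (∀ Φ : AlgFormula F (Fin n), Φ.toPoly = esymm (Fin n) F d →
          c * (n : ℝ) ^ 2 ≤ (Φ.size : ℝ)) ∧
        ((n : ℕ∞) < ENat.card F →
          ∃ Φ : AlgFormula F (Fin n), Φ.toPoly = esymm (Fin n) F d ∧
            (Φ.numVertices : ℝ) ≤ C * (n : ℝ) ^ 2) := by
  refine ⟨1 / 160, 17, by norm_num, by norm_num, 40, fun n hn d hd F _ => ?_⟩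
  obtain ⟨hlo, hhi⟩ := near_tenth_of_eq_floor_or_eq_ceil hd
  refine ⟨fun Φ hΦ => ?_, fun hF => ?_⟩
  · have hsize : (d - 1) * (n - d) ≤ 4 * Φ.size := by
      simpa using AlgFormula.mul_le_size_of_toPoly_eq_esymm hΦ
    have hsq : n ^ 2 ≤ 160 * Φ.size := calc
      n ^ 2 = n * n := pow_two n
      _ ≤ 20 * (d - 1) * (2 * (n - d)) := Nat.mul_le_mul (by omega) (by omega)
      _ = 40 * ((d - 1) * (n - d)) := by ring
      _ ≤ 160 * Φ.size := by omega
    have : (n : ℝ) ^ 2 ≤ 160 * Φ.size := by exact_mod_cast hsq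
    linarith
  · obtain ⟨Φ, hΦ, hcard⟩ := AlgFormula.exists_toPoly_eq_esymm (σ := Fin n) (d := d)
      (by simpa using hF) (by simp only [Fintype.card_fin]; omega)
    refine ⟨Φ, hΦ, ?_⟩
    rw [hcard, Fintype.card_fin]
    exact_mod_cast show 4 * (n + 1) ^ 2 + 1 ≤ 17 * n ^ 2 by nlinarith

theorem theorem1p3 :
    ∃ c C : ℝ, 0 < c ∧ 0 < C ∧ ∃ N : ℕ, ∀ n : ℕ, N ≤ n →
      ∀ d : ℕ, (d = ⌊(n : ℝ) / 10⌋₊ ∨ d = ⌈(n : ℝ) / 10⌉₊) →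
      ∀ (F : Type*) [Field F],
        -- every formula for `esym(n, 0.1n)` has size at least `c n²`
        ((ringChar F = 0 ∨ (n : ℝ) / 10 < (ringChar F : ℝ)) →
          ∀ Φ : AlgFormula F (Fin n), Φ.toPoly = MvPolynomial.esymm (Fin n) F d →
            c * (n : ℝ) ^ 2 ≤ (Φ.size : ℝ)) ∧
        -- the matching upper bound, over fields with more than `n` elements
        ((n : ℕ∞) < ENat.card F →
          ∃ Φ : AlgFormula F (Fin n), Φ.toPoly = MvPolynomial.esymm (Fin n) F d ∧
            (Φ.numVertices : ℝ) ≤ C * (n : ℝ) ^ 2) := by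
  obtain ⟨c, C, hc, hC, N, h⟩ := theorem1p3_general
  exact ⟨c, C, hc, hC, N, fun n hn d hd F _ => ⟨fun _ => (h n hn d hd F).1, (h n hn d hd F).2⟩⟩
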